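/- Let $m,n,N\ge 0$ be integers. Permutations are multiplied left to right ($\sigma\tau$ means first $\sigma$, then $\tau$), and $S_m\times S_n\subset S_{m+n}$ acts on the first $m$ and the last $n$ points. For complex $N\times N$ matrices $X,Y$ (upper index = row) and $\sigma\in S_{m+n}$ put $$\mathcal O_\sigma(X,Y)=\sum_{i_1,\dots,i_{m+n}=1}^{N}X^{i_1}_{i_{\sigma(1)}}\cdots X^{i_m}_{i_{\sigma(m)}}\,Y^{i_{m+1}}_{i_{\sigma(m+1)}}\cdots Y^{i_{m+n}}_{i_{\sigma(m+n)}} .$$ For $k\in\{m+n,m,n\}$ fix, for every Young diagram $R$ with $k$ boxes, an irreducible unitary representation $(V_R,D^R)$ of $S_k$ on $\mathbb C^{d_R}$, with different diagrams giving inequivalent representations. For diagrams $R,R_1,R_2$ with $m+n$, $m$, $n$ boxes let $g(R_1,R_2,R)$ be the multiplicity of $V_{R_1}\otimes V_{R_2}$ in $V_R$ restricted to $S_m\times S_n$. For every $R$ fix an orthonormal basis $|R_1,R_2,m_1,m_2;\nu\rangle$ of $V_R$ (with $1\le m_i\le d_{R_i}$, $1\le\nu\le g(R_1,R_2,R)$)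 such that $$D^R(\gamma_1,\gamma_2)\,|R_1,R_2,m_1,m_2;\nu\rangle=\sum_{k_1,k_2}D^{R_1}_{k_1m_1}(\gamma_1)\,D^{R_2}_{k_2m_2}(\gamma_2)\,|R_1,R_2,k_1,k_2;\nu\rangle$$ for all $(\gamma_1,\gamma_2)\in S_m\times S_n$. Define $$P^R_{R_1,R_2,\mu,\nu}=\sum_{m_1,m_2}|R_1,R_2,m_1,m_2;\mu\rangle\langle R_1,R_2,m_1,m_2;\nu|,\qquad \chi^R_{R_1,R_2,\mu,\nu}(\sigma)=\mathrm{Tr}\big(P^R_{R_1,R_2,\mu,\nu}D^R(\sigma)\big),$$ $$Q^R_{R_1,R_2,\mu,\nu}=\frac{d_R}{(m+n)!}\sum_{\sigma\in S_{m+n}}\chi^R_{R_1,R_2,\mu,\nu}(\sigma)\,\sigma^{-1}\in\mathbb C[S_{m+n}],\qquad \mathcal O^R_{R_1,R_2,\mu,\nu}(X,Y)=\sum_{\sigma\in S_{m+n}}\delta\big(Q^R_{R_1,R_2,\mu,\nu}\,\sigma^{-1}\big)\,\mathcal O_\sigma(X,Y),$$ where $\delta$ takes the coefficient of the identity. For positive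 definite Hermitian $N\times N$ matrices $A_x,A_y$ and a function $f$ of $(X,Y)$ let $$\langle f\rangle_{A_x,A_y}=\frac1{\Sigma[0]}\int [dX][dY]\,f(X,Y)\,e^{-\mathrm{Tr}(XA_xX^\dagger)-\mathrm{Tr}(YA_yY^\dagger)},\qquad \Sigma[0]=\int [dX][dY]\,e^{-\mathrm{Tr}(XA_xX^\dagger)-\mathrm{Tr}(YA_yY^\dagger)},$$ with Lebesgue measure on pairs of complex $N\times N$ matrices; $\dagger$ on a scalar is complex conjugation. Then for all Young diagrams $R,S$ with $m+n$ boxes, $R_1,S_1$ with $m$ boxes and $R_2,S_2$ with $n$ boxes, and all multiplicity indices $\mu_1,\nu_1\le g(R_1,R_2,R)$ and $\mu_2,\nu_2\le g(S_1,S_2,S)$: 1. (Coupling witnesses.) For all positive definite Hermitian $A_x,A_y$, with $B_x=A_x^{-1}$ and $B_y=A_y^{-1}$, $$\Big\langle \mathcal O^R_{R_1,R_2,\mu_1,\nu_1}(X,Y)\,\big(\mathcal O^S_{S_1,S_2,\mu_2,\nu_2}(X,Y)\big)^\dagger\Big\rangle_{A_x,A_y}=m!\,n!\;\delta_{RS}\,\delta_{R_1S_1}\,\delta_{R_2S_2}\,\delta_{\nu_1\nu_2}\;\mathcal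 O^R_{R_1,R_2,\mu_1,\mu_2}(B_x,B_y).$$ 2. (Classical witnesses.) For all complex $N\times N$ matrices $A_x,A_y$, with $B_x=A_x^\dagger A_x$ and $B_y=A_y^\dagger A_y$, $$\Big\langle \mathcal O^R_{R_1,R_2,\mu_1,\nu_1}(XA_x,YA_y)\,\big(\mathcal O^S_{S_1,S_2,\mu_2,\nu_2}(XA_x,YA_y)\big)^\dagger\Big\rangle_{\mathbb I,\mathbb I}=m!\,n!\;\delta_{RS}\,\delta_{R_1S_1}\,\delta_{R_2S_2}\,\delta_{\nu_1\nu_2}\;\mathcal O^R_{R_1,R_2,\mu_1,\mu_2}(B_x,B_y).$$ In both cases $\Sigma[0]\ne0$ and all the integrals converge absolutely. -/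

import Mathlib

namespace TwoMatrix

open MeasureTheory Matrix
open scoped TensorProduct

/-! ### Permutations -/

/-- The symmetric group `S_k` with the left-to-right product: `σ * τ` is "first `σ`, then `τ`".
Mathlib's product on `Equiv.Perm` is "first `τ`, then `σ`", hence the opposite group. -/
abbrev SymGrp (k : ℕ) : Type := (Equiv.Perm (Fin k))ᵐᵒᵖ

instance instFintypeSymGrp (k : ℕ) : Fintype (SymGrp k) :=
  Fintype.ofEquiv (Equiv.Perm (Fin k)) MulOpposite.opEquiv

/-- The permutation of `Fin (m + n)` that acts as `α` on the first `m` points and as `β` on the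
last `n` points. -/
def blockPerm (m n : ℕ) (α : Equiv.Perm (Fin m)) (β : Equiv.Perm (Fin n)) :
    Equiv.Perm (Fin (m + n)) :=
  finSumFinEquiv.permCongr (Equiv.sumCongr α β)

/-- The inclusion `S_m × S_n → S_{m+n}`. -/
def blockHom (m n : ℕ) : SymGrp m × SymGrp n →* SymGrp (m + n) where
  toFun γ := MulOpposite.op (blockPerm m n γ.1.unop γ.2.unop)
  map_one' := by
    apply MulOpposite.unop_injective
    ext a
    refine Fin.addCases (fun i => ?_) (fun i => ?_) a <;> simp [blockPerm, Equiv.permCongr_apply]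
  map_mul' γ γ' := by
    apply MulOpposite.unop_injective
    ext a
    refine Fin.addCases (fun i => ?_) (fun i => ?_) a <;> simp [blockPerm, Equiv.permCongr_apply]

/-- The functional `δ` on the group algebra `ℂ[S_k]`: the coefficient of the identity. -/
noncomputable def groupDelta {k : ℕ} (a : MonoidAlgebra ℂ (SymGrp k)) : ℂ := a.coeff 1

/-! ### Irreducible representations and the subgroup basis -/

/-- A choice, for every partition (Young diagram) `R` of `k`, of an irreducible unitary
representation of `S_k` on `ℂ ^ (dim R)`, different partitions giving inequivalent
representations.  As there are as many irreducible representations of `S_k` as partitions of `k`,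
every irreducible representation occurs. -/
structure IrrepSystem (k : ℕ) where
  /-- the dimension `d_R` -/
  dim : Nat.Partition k → ℕ
  /-- the representation `D^R` -/
  rep : ∀ R, Representation ℂ (SymGrp k) (EuclideanSpace ℂ (Fin (dim R)))
  unitary : ∀ R σ v w, inner ℂ (rep R σ v) (rep R σ w) = inner ℂ v w
  irreducible : ∀ R, (rep R).IsIrreducible
  inequivalent : ∀ R S, R ≠ S → IsEmpty ((rep R).Equiv (rep S))

namespace IrrepSystem

/-- The space `V_R`. -/
abbrev space {k : ℕ} (D : IrrepSystem k) (R : Nat.Partition k) : Type :=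
  EuclideanSpace ℂ (Fin (D.dim R))

/-- The matrix element `D^R_{ij}(σ)` in the standard basis of `V_R`. -/
noncomputable def entry {k : ℕ} (D : IrrepSystem k) (R : Nat.Partition k) (σ : SymGrp k)
    (i j : Fin (D.dim R)) : ℂ :=
  D.rep R σ (EuclideanSpace.single j 1) i

end IrrepSystem

section Subgroup

variable {m n : ℕ} (D : IrrepSystem (m + n)) (D₁ : IrrepSystem m) (D₂ : IrrepSystem n)

/-- The representation `V_{R₁} ⊗ V_{R₂}` of `S_m × S_n`. -/
noncomputable def outerRep (R₁ : Nat.Partition m) (R₂ : Nat.Partition n) :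
    Representation ℂ (SymGrp m × SymGrp n) (D₁.space R₁ ⊗[ℂ] D₂.space R₂) :=
  Representation.tprod ((D₁.rep R₁).comp (MonoidHom.fst (SymGrp m) (SymGrp n)))
    ((D₂.rep R₂).comp (MonoidHom.snd (SymGrp m) (SymGrp n)))

/-- The restriction of `V_R` to `S_m × S_n ⊆ S_{m+n}`. -/
noncomputable def restrictedRep (R : Nat.Partition (m + n)) :
    Representation ℂ (SymGrp m × SymGrp n) (D.space R) :=
  (D.rep R).comp (blockHom m n)

/-- The multiplicity `g(R₁, R₂, R)` of `V_{R₁} ⊗ V_{R₂}` in the restriction of `V_R` to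
`S_m × S_n`: the dimension of the space of intertwiners. -/
noncomputable def branchingMult (R : Nat.Partition (m + n)) (R₁ : Nat.Partition m)
    (R₂ : Nat.Partition n) : ℕ :=
  Module.finrank ℂ (Representation.IntertwiningMap (outerRep D₁ D₂ R₁ R₂) (restrictedRep D R))

/-- A basis of `V_R` adapted to `V_R = ⨁ V_{R₁} ⊗ V_{R₂} ⊗ V^R_{R₁,R₂}`: an orthonormal basis of
vectors `|R₁, R₂, m₁, m₂; ν⟩`, such that `S_m × S_n` acts on the labels `m₁, m₂` through the
matrices of `V_{R₁}` and `V_{R₂}` and does not act on the multiplicity label `ν`. -/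
structure SubgroupBasis (R : Nat.Partition (m + n)) where
  basis : OrthonormalBasis
    (Σ p : Nat.Partition m × Nat.Partition n,
      (Fin (D₁.dim p.1) × Fin (D₂.dim p.2)) × Fin (branchingMult D D₁ D₂ R p.1 p.2))
    ℂ (D.space R)
  action : ∀ (γ₁ : SymGrp m) (γ₂ : SymGrp n) (R₁ : Nat.Partition m) (R₂ : Nat.Partition n)
    (m₁ : Fin (D₁.dim R₁)) (m₂ : Fin (D₂.dim R₂)) (ν : Fin (branchingMult D D₁ D₂ R R₁ R₂)),
    D.rep R (blockHom m n (γ₁, γ₂)) (basis ⟨(R₁, R₂), ((m₁, m₂), ν)⟩) =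
      ∑ k₁ : Fin (D₁.dim R₁), ∑ k₂ : Fin (D₂.dim R₂),
        (D₁.entry R₁ γ₁ k₁ m₁ * D₂.entry R₂ γ₂ k₂ m₂) • basis ⟨(R₁, R₂), ((k₁, k₂), ν)⟩

variable {D D₁ D₂}

namespace SubgroupBasis

variable {R : Nat.Partition (m + n)} (E : SubgroupBasis D D₁ D₂ R)
  (R₁ : Nat.Partition m) (R₂ : Nat.Partition n)

/-- The vector `|R₁, R₂, m₁, m₂; ν⟩` of `V_R`. -/
noncomputable def ket (m₁ : Fin (D₁.dim R₁)) (m₂ : Fin (D₂.dim R₂))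
    (ν : Fin (branchingMult D D₁ D₂ R R₁ R₂)) : D.space R :=
  E.basis ⟨(R₁, R₂), ((m₁, m₂), ν)⟩

/-- `P^R_{R₁,R₂,μ,ν} = ∑ |R₁, R₂, m₁, m₂; μ⟩ ⟨R₁, R₂, m₁, m₂; ν|`, the sum over `m₁, m₂`. -/
noncomputable def projector (μ ν : Fin (branchingMult D D₁ D₂ R R₁ R₂)) :
    D.space R →ₗ[ℂ] D.space R :=
  ∑ m₁ : Fin (D₁.dim R₁), ∑ m₂ : Fin (D₂.dim R₂),
    (InnerProductSpace.rankOne ℂ (E.ket R₁ R₂ m₁ m₂ μ) (E.ket R₁ R₂ m₁ m₂ ν) :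
      D.space R →ₗ[ℂ] D.space R)

/-- The restricted character `χ^R_{R₁,R₂,μ,ν}(σ) = Tr (P^R_{R₁,R₂,μ,ν} D^R(σ))`. -/
noncomputable def restrictedCharacter (μ ν : Fin (branchingMult D D₁ D₂ R R₁ R₂))
    (σ : SymGrp (m + n)) : ℂ :=
  LinearMap.trace ℂ (D.space R) (E.projector R₁ R₂ μ ν ∘ₗ D.rep R σ)

/-- The `Q`-basis element
`Q^R_{R₁,R₂,μ,ν} = (d_R / (m+n)!) ∑_σ χ^R_{R₁,R₂,μ,ν}(σ) σ⁻¹` of `ℂ[S_{m+n}]`. -/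
noncomputable def qElement (μ ν : Fin (branchingMult D D₁ D₂ R R₁ R₂)) :
    MonoidAlgebra ℂ (SymGrp (m + n)) :=
  ((D.dim R : ℂ) / ((m + n).factorial : ℂ)) •
    ∑ σ : SymGrp (m + n), MonoidAlgebra.single σ⁻¹ (E.restrictedCharacter R₁ R₂ μ ν σ)

end SubgroupBasis

end Subgroup

/-! ### Gauge invariant operators -/

/-- `O_σ(X, Y)`: the sum over all indices `i_1, …, i_{m+n}` of
`X^{i_1}_{i_σ(1)} ⋯ X^{i_m}_{i_σ(m)} Y^{i_{m+1}}_{i_σ(m+1)} ⋯ Y^{i_{m+n}}_{i_σ(m+n)}`, where the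
upper index is the row. -/
noncomputable def permOp {m n N : ℕ} (σ : SymGrp (m + n)) (X Y : Matrix (Fin N) (Fin N) ℂ) : ℂ :=
  ∑ i : Fin (m + n) → Fin N,
    (∏ a : Fin m, X (i (Fin.castAdd n a)) (i (σ.unop (Fin.castAdd n a)))) *
      ∏ b : Fin n, Y (i (Fin.natAdd m b)) (i (σ.unop (Fin.natAdd m b)))

/-- The Fourier (restricted Schur, `Q`-basis) operator
`O^R_{R₁,R₂,μ,ν}(X, Y) = ∑_σ δ(Q^R_{R₁,R₂,μ,ν} σ⁻¹) O_σ(X, Y)`. -/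
noncomputable def fourierOp {m n N : ℕ} {D : IrrepSystem (m + n)} {D₁ : IrrepSystem m}
    {D₂ : IrrepSystem n} {R : Nat.Partition (m + n)} (E : SubgroupBasis D D₁ D₂ R)
    (R₁ : Nat.Partition m) (R₂ : Nat.Partition n) (μ ν : Fin (branchingMult D D₁ D₂ R R₁ R₂))
    (X Y : Matrix (Fin N) (Fin N) ℂ) : ℂ :=
  ∑ σ : SymGrp (m + n),
    groupDelta (E.qElement R₁ R₂ μ ν * MonoidAlgebra.single σ⁻¹ 1) * permOp σ X Y

/-! ### The matrix integral -/

/-- Pairs `(X, Y)` of complex `N × N` matrices given by their entries; `volume` on this space is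
the Lebesgue measure `[dX][dY]`. -/
abbrev Pairs (N : ℕ) : Type := (Fin N → Fin N → ℂ) × (Fin N → Fin N → ℂ)

/-- The weight `exp(-Tr(X A_x X†) - Tr(Y A_y Y†))`. -/
noncomputable def weight {N : ℕ} (Ax Ay : Matrix (Fin N) (Fin N) ℂ) (p : Pairs N) : ℂ :=
  Complex.exp (-(Matrix.of p.1 * Ax * (Matrix.of p.1)ᴴ).trace
    - (Matrix.of p.2 * Ay * (Matrix.of p.2)ᴴ).trace)

/-- The partition function `Σ[0]`. -/
noncomputable def partitionFunction {N : ℕ} (Ax Ay : Matrix (Fin N) (Fin N) ℂ) : ℂ :=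
  ∫ p : Pairs N, weight Ax Ay p

/-- The expectation value `⟨f(X, Y)⟩` in the model with couplings `A_x`, `A_y`. -/
noncomputable def expectation {N : ℕ} (Ax Ay : Matrix (Fin N) (Fin N) ℂ)
    (f : Matrix (Fin N) (Fin N) ℂ → Matrix (Fin N) (Fin N) ℂ → ℂ) : ℂ :=
  1 / partitionFunction Ax Ay *
    ∫ p : Pairs N, f (Matrix.of p.1) (Matrix.of p.2) * weight Ax Ay p

/-- The Gaussian integrals that define `⟨f(X, Y)⟩` converge absolutely, the partition function
does not vanish, and `⟨f(X, Y)⟩ = v`. -/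
def HasExpectation {N : ℕ} (Ax Ay : Matrix (Fin N) (Fin N) ℂ)
    (f : Matrix (Fin N) (Fin N) ℂ → Matrix (Fin N) (Fin N) ℂ → ℂ) (v : ℂ) : Prop :=
  Integrable (fun p : Pairs N => weight Ax Ay p) ∧
  partitionFunction Ax Ay ≠ 0 ∧
  Integrable (fun p : Pairs N => f (Matrix.of p.1) (Matrix.of p.2) * weight Ax Ay p) ∧
  expectation Ax Ay f = v

end TwoMatrix

open scoped ComplexOrder

/-!
The proof has three ingredients.

*Gaussian integration.* For unit couplings the entries of `X` are independent standard complex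
Gaussians.  The moments `∫ z ^ p * conj z ^ q * exp (-|z|²) = π p! δ_{pq}` of one entry multiply to
the moments of all of them, and a product of factorials over the fibres of a labelling counts the
permutations that preserve the labelling, which is Wick's theorem (`hasIntegralEq_entries`).  By
linearity the entries of `X A` have covariance `δ_{ik} (A† A)_{lj}`, so the two-point function of
two permutation operators is `∑_γ O_{σ γ τ⁻¹ γ⁻¹}(A_x† A_x, A_y† A_y)`, with one Wick contraction for
each `γ ∈ S_m × S_n` (`hasIntegralEq_permOp`).

*Representation theory.* The coefficients of `Q^R_{R₁,R₂,μ,ν}` are matrix elements of `V_R`.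
Complex conjugation exchanges `μ` and `ν` and inverts the permutation, because `V_R` is unitary, and
conjugation by `γ ∈ S_m × S_n` changes nothing, because `P^R_{R₁,R₂,μ,ν}` commutes with `γ`.  So all
`m! n!` contractions contribute equally (`sum_contractions_eq`), each of them through the product
`Q^R_{R₁,R₂,μ₁,ν₁} Q^S_{S₁,S₂,ν₂,μ₂}` in the group algebra.  Schur orthogonality evaluates this
product: the `Q`-basis multiplies like matrix units (`sum_qCoeff_mul`, `sum_qCoeff_mul_of_ne`,
`sum_qCoeff_mul_of_ne_label`).  This proves the statement on classical witnesses.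

*Change of variables.* If `C A C† = 1`, then the substitution `X ↦ X C` turns the weight with
coupling `A` into the weight with unit coupling, and `C† C = A⁻¹`.  The Jacobian cancels against
that of the partition function (`HasExpectation.of_one_one`), so the statement on coupling witnesses
follows from the one on classical witnesses.
-/

namespace TwoMatrix

open MeasureTheory Matrix

/-! ### Gaussian moments of a complex matrix -/

/-- `f` is integrable, with integral `v`. -/
def HasIntegralEq {α : Type*} [MeasurableSpace α] (μ : Measure α) (f : α → ℂ) (v : ℂ) : Prop :=
  Integrable f μ ∧ ∫ x, f x ∂μ = v

namespace HasIntegralEq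

variable {α β : Type*} [MeasurableSpace α] [MeasurableSpace β] {μ : Measure α} {ν : Measure β}

theorem const_mul {f : α → ℂ} {v : ℂ} (c : ℂ) (hf : HasIntegralEq μ f v) :
    HasIntegralEq μ (fun x => c * f x) (c * v) :=
  ⟨hf.1.const_mul c, by rw [integral_const_mul, hf.2]⟩

theorem sum {κ : Type*} {s : Finset κ} {f : κ → α → ℂ} {v : κ → ℂ}
    (hf : ∀ k ∈ s, HasIntegralEq μ (f k) (v k)) :
    HasIntegralEq μ (fun x => ∑ k ∈ s, f k x) (∑ k ∈ s, v k) :=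
  ⟨integrable_finsetSum s fun k hk => (hf k hk).1, by
    rw [integral_finsetSum s fun k hk => (hf k hk).1]
    exact Finset.sum_congr rfl fun k hk => (hf k hk).2⟩

theorem mul_prod [SFinite μ] [SFinite ν] {f : α → ℂ} {g : β → ℂ} {v w : ℂ}
    (hf : HasIntegralEq μ f v) (hg : HasIntegralEq ν g w) :
    HasIntegralEq (μ.prod ν) (fun x => f x.1 * g x.2) (v * w) :=
  ⟨hf.1.mul_prod hg.1, by rw [integral_prod_mul, hf.2, hg.2]⟩

theorem fintype_prod {κ : Type*} [Fintype κ] {E : κ → Type*} [∀ k, MeasureSpace (E k)]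
    [∀ k, SigmaFinite (volume : Measure (E k))] {f : ∀ k, E k → ℂ} {v : κ → ℂ}
    (hf : ∀ k, HasIntegralEq volume (f k) (v k)) :
    HasIntegralEq volume (fun x : ∀ k, E k => ∏ k, f k (x k)) (∏ k, v k) :=
  ⟨Integrable.fintype_prod_dep fun k => (hf k).1, by
    rw [integral_fintype_prod_volume_eq_prod]
    exact Finset.prod_congr rfl fun k _ => (hf k).2⟩

end HasIntegralEq

/-- The weight `exp (-|z|²)` on the complex plane. -/
noncomputable def cexpNormSq (z : ℂ) : ℂ := Complex.exp (-((‖z‖ ^ 2 : ℝ) : ℂ))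

theorem cexpNormSq_eq (z : ℂ) : cexpNormSq z = ((Real.exp (-‖z‖ ^ (2 : ℝ)) : ℝ) : ℂ) := by
  simp [cexpNormSq]

theorem integral_norm_pow_mul_exp (k : ℕ) :
    ∫ z : ℂ, ‖z‖ ^ (k : ℝ) * Real.exp (-‖z‖ ^ (2 : ℝ)) =
      Real.pi * Real.Gamma ((k + 2) / 2) := by
  rw [Complex.integral_rpow_mul_exp_neg_rpow (p := 2) (q := k) (by norm_num)
    (by have : (0 : ℝ) ≤ k := k.cast_nonneg
        linarith)]
  ring

/-- A function that is not integrable has integral `0`, whereas this integral is positive. -/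
theorem integrable_norm_pow_mul_exp (k : ℕ) :
    Integrable fun z : ℂ => ‖z‖ ^ (k : ℝ) * Real.exp (-‖z‖ ^ (2 : ℝ)) := by
  apply Integrable.of_integral_ne_zero
  rw [integral_norm_pow_mul_exp]
  have : 0 < Real.Gamma (((k : ℝ) + 2) / 2) := Real.Gamma_pos_of_pos (by positivity)
  exact (mul_pos Real.pi_pos this).ne'

theorem integrable_monomial (p q : ℕ) :
    Integrable fun z : ℂ => z ^ p * star z ^ q * cexpNormSq z := by
  refine (integrable_norm_pow_mul_exp (p + q)).mono' ?_ (Filter.Eventually.of_forall fun z => ?_)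
  · apply Continuous.aestronglyMeasurable
    unfold cexpNormSq
    fun_prop
  · rw [cexpNormSq_eq, norm_mul, norm_mul, norm_pow, norm_pow, norm_star, Complex.norm_real,
      Real.norm_eq_abs, abs_of_pos (Real.exp_pos _), Real.rpow_natCast, pow_add]

/-- Off the diagonal the integral vanishes because the integrand has nonzero charge under the
rotations `z ↦ ω z`. -/
theorem integral_monomial (p q : ℕ) :
    ∫ z : ℂ, z ^ p * star z ^ q * cexpNormSq z =
      if p = q then (Real.pi : ℂ) * (p.factorial : ℂ) else 0 := by
  split_ifs with h
  · subst h
    have h1 : ∀ z : ℂ, z ^ p * star z ^ p * cexpNormSq z =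
        ((‖z‖ ^ ((2 * p : ℕ) : ℝ) * Real.exp (-‖z‖ ^ (2 : ℝ)) : ℝ) : ℂ) := by
      intro z
      rw [cexpNormSq_eq, ← mul_pow, Complex.star_def, Complex.mul_conj', Real.rpow_natCast, pow_mul]
      push_cast
      ring
    simp_rw [h1]
    rw [integral_complex_ofReal, integral_norm_pow_mul_exp]
    have : (((2 * p : ℕ) : ℝ) + 2) / 2 = p + 1 := by push_cast; ring
    rw [this, Real.Gamma_nat_eq_factorial]
    push_cast
    ring
  · -- rotate by the angle `π / (p - q)`, so that the integrand changes its sign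
    set θ : ℝ := Real.pi / ((p : ℝ) - q) with hθ
    have hpq : ((p : ℝ) - q) ≠ 0 := sub_ne_zero.2 (by exact_mod_cast h)
    let ω : Circle := Circle.exp θ
    have hω : (ω : ℂ) ^ p * star (ω : ℂ) ^ q = -1 := by
      have : star (ω : ℂ) = Complex.exp (-(θ * Complex.I)) := by
        rw [Circle.coe_exp, Complex.star_def, ← Complex.exp_conj]
        simp
      rw [this, Circle.coe_exp, ← Complex.exp_nat_mul, ← Complex.exp_nat_mul, ← Complex.exp_add]
      have : (p : ℂ) * (θ * Complex.I) + q * -(θ * Complex.I) = Real.pi * Complex.I := by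
        have h2 : ((p : ℂ) - q) * θ = Real.pi := by
          rw [hθ]
          have : ((p : ℂ) - q) ≠ 0 := by exact_mod_cast hpq
          push_cast
          field_simp
        linear_combination Complex.I * h2
      rw [this, Complex.exp_pi_mul_I]
    refine self_eq_neg.1 ?_
    rw [← integral_neg, ← (rotation ω).measurePreserving.integral_comp
      (rotation ω).toHomeomorph.measurableEmbedding]
    congr 1
    ext z
    have hn : cexpNormSq (rotation ω z) = cexpNormSq z := by
      simp only [cexpNormSq, LinearIsometryEquiv.norm_map]
    rw [hn, rotation_apply, star_mul', mul_pow, mul_pow]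
    linear_combination (z ^ p * star z ^ q * cexpNormSq z) * hω

theorem hasIntegralEq_monomial (p q : ℕ) :
    HasIntegralEq volume (fun z : ℂ => z ^ p * star z ^ q * cexpNormSq z)
      (if p = q then (Real.pi : ℂ) * (p.factorial : ℂ) else 0) :=
  ⟨integrable_monomial p q, integral_monomial p q⟩

section Count

variable {α κ : Type*} [Fintype α] [DecidableEq α] [Fintype κ] [DecidableEq κ]

omit [DecidableEq α] [Fintype κ] in
/-- Two labellings with equally many points of each label differ by a permutation. -/
theorem exists_perm_of_card_fiber_eq (u v : α → κ)
    (h : ∀ c, Fintype.card {a // u a = c} = Fintype.card {a // v a = c}) :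
    ∃ τ : Equiv.Perm α, ∀ a, v (τ a) = u a := by
  let e := fun c => Fintype.equivOfCardEq (h c)
  refine ⟨(Equiv.sigmaFiberEquiv u).symm.trans
    ((Equiv.sigmaCongrRight e).trans (Equiv.sigmaFiberEquiv v)), fun a => ?_⟩
  exact (e (u a) ⟨a, rfl⟩).2

/-- The number of permutations that carry one labelling to another. -/
theorem sum_perm_prod_ite (u v : α → κ) :
    (∑ τ : Equiv.Perm α, ∏ a, if u a = v (τ a) then (1 : ℂ) else 0) =
      ∏ c, if Fintype.card {a // u a = c} = Fintype.card {a // v a = c} then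
        ((Fintype.card {a // u a = c}).factorial : ℂ) else 0 := by
  by_cases h : ∀ c, Fintype.card {a // u a = c} = Fintype.card {a // v a = c}
  · -- the permutations carrying `u` to `v` form a coset of the stabilizer of `v`
    obtain ⟨τ₀, hτ₀⟩ := exists_perm_of_card_fiber_eq u v h
    simp_rw [if_pos (h _)]
    have h1 : ∀ τ : Equiv.Perm α, (∏ a, if u a = v (τ a) then (1 : ℂ) else 0) =
        if v ∘ (τ * τ₀⁻¹) = v then 1 else 0 := by
      intro τ
      rw [Fintype.prod_ite_zero]
      simp only [Finset.prod_const_one]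
      congr 1
      rw [eq_iff_iff, funext_iff, ← τ₀.forall_congr_right (q := fun a => (v ∘ (τ * τ₀⁻¹)) a = v a)]
      simp [hτ₀, eq_comm]
    simp_rw [h1]
    refine (Fintype.sum_equiv (Equiv.mulRight τ₀⁻¹) _
      (fun τ : Equiv.Perm α => if v ∘ τ = v then (1 : ℂ) else 0) fun _ => rfl).trans ?_
    rw [Finset.sum_boole, ← Fintype.card_subtype, DomMulAct.stabilizer_card]
    push_cast
    simp_rw [h]
  · obtain ⟨c, hc⟩ := not_forall.1 h
    rw [Finset.prod_eq_zero (Finset.mem_univ c) (if_neg hc)]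
    refine Finset.sum_eq_zero fun τ _ => ?_
    rw [Fintype.prod_ite_zero, if_neg]
    intro hτ
    exact hc (Fintype.card_congr (τ.subtypeEquiv fun a => by rw [hτ a]))

end Count

section Matrix

variable {α κ : Type*} [Fintype α] [DecidableEq α] [Fintype κ] [DecidableEq κ]

/-- The weight `exp (-Tr (X X†))` on complex matrices. -/
noncomputable def matrixWeight (x : κ → κ → ℂ) : ℂ := ∏ i, ∏ j, cexpNormSq (x i j)

variable (κ) in
/-- The integral of `exp (-Tr (X X†))`. -/
noncomputable def gaussMass : ℂ := ∏ _i : κ, ∏ _j : κ, (Real.pi : ℂ)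

omit [DecidableEq κ] in
theorem gaussMass_ne_zero : gaussMass κ ≠ 0 :=
  Finset.prod_ne_zero_iff.2 fun _ _ => Finset.prod_ne_zero_iff.2 fun _ _ => by
    exact_mod_cast Real.pi_ne_zero

omit [DecidableEq α] in
theorem prod_entries_eq (u : α → κ × κ) (x : κ → κ → ℂ) :
    ∏ a, x (u a).1 (u a).2 = ∏ i, ∏ j, x i j ^ Fintype.card {a // u a = (i, j)} := by
  rw [← Fintype.prod_prod_type' (f := fun i j => x i j ^ Fintype.card {a // u a = (i, j)}),
    ← Fintype.prod_fiberwise' u (fun c : κ × κ => x c.1 c.2)]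
  refine Finset.prod_congr rfl fun c _ => ?_
  simp [Finset.prod_const]

/-- Wick's theorem for the entries of a matrix. -/
theorem hasIntegralEq_entries (u v : α → κ × κ) :
    HasIntegralEq volume
      (fun x : κ → κ → ℂ => (∏ a, x (u a).1 (u a).2) * star (∏ a, x (v a).1 (v a).2) *
        matrixWeight x)
      (gaussMass κ * ∑ τ : Equiv.Perm α, ∏ a, if u a = v (τ a) then 1 else 0) := by
  have h := HasIntegralEq.fintype_prod fun i : κ => HasIntegralEq.fintype_prod fun j : κ =>
    hasIntegralEq_monomial (Fintype.card {a // u a = (i, j)}) (Fintype.card {a // v a = (i, j)})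
  convert h using 1
  · ext x
    rw [prod_entries_eq, prod_entries_eq, matrixWeight, star_prod]
    simp_rw [star_prod, star_pow, ← Finset.prod_mul_distrib]
  · rw [sum_perm_prod_ite, gaussMass, Fintype.prod_prod_type]
    simp_rw [← Finset.prod_mul_distrib, mul_ite, mul_zero]

/-- Wick's theorem for the entries of `X A`: the covariance of `(X A)_{ij}` and `(X A)_{kl}` is
`δ_{ik} (A† A)_{lj}`. -/
theorem hasIntegralEq_entries_mul (A : Matrix κ κ ℂ) (u v : α → κ × κ) :
    HasIntegralEq volume
      (fun x : κ → κ → ℂ => (∏ a, (Matrix.of x * A) (u a).1 (u a).2) *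
        star (∏ a, (Matrix.of x * A) (v a).1 (v a).2) * matrixWeight x)
      (gaussMass κ * ∑ τ : Equiv.Perm α, ∏ a,
        if (u a).1 = (v (τ a)).1 then (Aᴴ * A) (v (τ a)).2 (u a).2 else 0) := by
  have h : HasIntegralEq volume (fun x : κ → κ → ℂ => ∑ c : α → κ, ∑ d : α → κ,
      ((∏ a, A (c a) (u a).2) * star (∏ a, A (d a) (v a).2)) *
        ((∏ a, x (u a).1 (c a)) * star (∏ a, x (v a).1 (d a)) * matrixWeight x)) _ :=
    HasIntegralEq.sum fun c _ => HasIntegralEq.sum fun d _ => HasIntegralEq.const_mul _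
      (hasIntegralEq_entries (fun a => ((u a).1, c a)) (fun a => ((v a).1, d a)))
  convert h using 1
  · ext x
    simp_rw [Matrix.mul_apply, Finset.prod_univ_sum, Fintype.piFinset_univ, star_sum,
      Finset.sum_mul_sum, Finset.sum_mul, Finset.prod_mul_distrib, Matrix.of_apply, star_mul']
    refine Finset.sum_congr rfl fun c _ => Finset.sum_congr rfl fun d _ => ?_
    ring
  · simp_rw [mul_left_comm _ (gaussMass κ), ← Finset.mul_sum]
    congr 1
    simp_rw [Finset.mul_sum]
    rw [Finset.sum_congr rfl fun c _ => Finset.sum_comm, Finset.sum_comm]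
    refine Finset.sum_congr rfl fun τ _ => ?_
    let K : α → κ → κ → ℂ := fun a c d => A c (u a).2 * star (A d (v (τ a)).2) *
      if (u a).1 = (v (τ a)).1 ∧ c = d then 1 else 0
    have hK : ∀ a, (if (u a).1 = (v (τ a)).1 then (Aᴴ * A) (v (τ a)).2 (u a).2 else 0) =
        ∑ c, ∑ d, K a c d := by
      intro a
      by_cases ha : (u a).1 = (v (τ a)).1 <;>
        simp [K, ha, Matrix.mul_apply, mul_comm]
    simp_rw [hK, Finset.prod_univ_sum, Fintype.piFinset_univ]
    refine Finset.sum_congr rfl fun c _ => ?_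
    -- relabel the second set of contracted indices by `τ`, so that the sums factorize
    rw [← Equiv.sum_comp (Equiv.arrowCongr τ.symm (Equiv.refl κ))]
    refine Finset.sum_congr rfl fun d _ => ?_
    rw [← Equiv.prod_comp τ (fun a => A (d a) (v a).2), star_prod, ← Finset.prod_mul_distrib,
      ← Finset.prod_mul_distrib]
    refine Finset.prod_congr rfl fun a _ => ?_
    simp [K]

end Matrix

/-! ### Two-point functions of the permutation operators -/

section TwoPoint

variable {m n N : ℕ}

/-- The matrix in slot `s` of a gauge invariant operator: `X` in the first `m` slots, `Y` in the
last `n`. -/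
def slot {M : Type*} (X Y : M) (s : Fin (m + n)) : M :=
  Fin.addCases (fun _ => X) (fun _ => Y) s

theorem permOp_eq_sum_prod_slot (σ : SymGrp (m + n)) (X Y : Matrix (Fin N) (Fin N) ℂ) :
    permOp σ X Y =
      ∑ i : Fin (m + n) → Fin N, ∏ s, slot (m := m) (n := n) X Y s (i s) (i (σ.unop s)) := by
  simp [permOp, slot, Fin.prod_univ_add]

@[simp] theorem blockPerm_castAdd (α : Equiv.Perm (Fin m)) (β : Equiv.Perm (Fin n)) (a : Fin m) :
    blockPerm m n α β (Fin.castAdd n a) = Fin.castAdd n (α a) := by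
  simp [blockPerm, Equiv.permCongr_apply]

@[simp] theorem blockPerm_natAdd (α : Equiv.Perm (Fin m)) (β : Equiv.Perm (Fin n)) (b : Fin n) :
    blockPerm m n α β (Fin.natAdd m b) = Fin.natAdd m (β b) := by
  simp [blockPerm, Equiv.permCongr_apply]

theorem weight_one_one (p : Pairs N) : weight 1 1 p = matrixWeight p.1 * matrixWeight p.2 := by
  have h : ∀ x : Fin N → Fin N → ℂ, matrixWeight x =
      Complex.exp (-(Matrix.of x * 1 * (Matrix.of x)ᴴ).trace) := by
    intro x
    simp only [matrixWeight, cexpNormSq, ← Complex.exp_sum, Matrix.trace, Matrix.diag,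
      Matrix.mul_one, Matrix.mul_apply, Matrix.conjTranspose_apply, Matrix.of_apply,
      Finset.sum_neg_distrib]
    simp [Complex.mul_conj']
  rw [weight, h, h, ← Complex.exp_add, sub_eq_add_neg]

theorem hasIntegralEq_weight_one_one :
    HasIntegralEq volume (fun p : Pairs N => weight 1 1 p)
      (gaussMass (Fin N) * gaussMass (Fin N)) := by
  have h : HasIntegralEq volume (fun x : Fin N → Fin N → ℂ => matrixWeight x)
      (gaussMass (Fin N)) := by
    simpa using hasIntegralEq_entries (κ := Fin N) (α := Fin 0) Fin.elim0 Fin.elim0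
  simp_rw [weight_one_one]
  exact h.mul_prod h

/-- Contracting the indices of `O_σ(X A, Y A')` and of the conjugate of `O_τ(X A, Y A')` along a
permutation `γ` gives a permutation operator in the covariances. -/
theorem sum_contraction (σ τ : SymGrp (m + n)) (γ : Equiv.Perm (Fin (m + n)))
    (M : Fin (m + n) → Matrix (Fin N) (Fin N) ℂ) :
    (∑ i : Fin (m + n) → Fin N, ∑ k : Fin (m + n) → Fin N,
      ∏ s, if i s = k (γ s) then M s (k (τ.unop (γ s))) (i (σ.unop s)) else 0) =
    ∑ i : Fin (m + n) → Fin N, ∏ s, M s (i s)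
      (i ((σ * MulOpposite.op γ * τ⁻¹ * (MulOpposite.op γ)⁻¹).unop s)) := by
  rw [← Equiv.sum_comp (Equiv.arrowCongr (γ⁻¹ * τ.unop * γ).symm (Equiv.refl (Fin N)))
    (fun i => ∏ s, M s (i s) _)]
  refine Finset.sum_congr rfl fun i _ => ?_
  -- the Kronecker deltas leave only the labelling `k = i ∘ γ⁻¹`
  rw [Finset.sum_eq_single (i ∘ γ.symm)]
  · simp [Equiv.Perm.mul_apply, Equiv.Perm.inv_def]
  · intro k _ hk
    rw [Fintype.prod_ite_zero, if_neg]
    intro h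
    apply hk
    ext s
    simp [h]
  · simp

/-- The two-point function of the permutation operators: the Wick contractions are labelled by
`S_m × S_n`. -/
theorem hasIntegralEq_permOp (σ τ : SymGrp (m + n)) (Ax Ay : Matrix (Fin N) (Fin N) ℂ) :
    HasIntegralEq volume
      (fun p : Pairs N => permOp σ (Matrix.of p.1 * Ax) (Matrix.of p.2 * Ay) *
        star (permOp τ (Matrix.of p.1 * Ax) (Matrix.of p.2 * Ay)) * weight 1 1 p)
      (gaussMass (Fin N) * gaussMass (Fin N) * ∑ γ : SymGrp m × SymGrp n,
        permOp (σ * blockHom m n γ * τ⁻¹ * (blockHom m n γ)⁻¹) (Axᴴ * Ax) (Ayᴴ * Ay)) := by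
  have h : HasIntegralEq (volume : Measure (Pairs N)) _ _ :=
    HasIntegralEq.sum (s := Finset.univ) fun (i : Fin (m + n) → Fin N) _ =>
    HasIntegralEq.sum (s := Finset.univ) fun (k : Fin (m + n) → Fin N) _ =>
    HasIntegralEq.mul_prod
      (hasIntegralEq_entries_mul Ax
        (fun a => (i (Fin.castAdd n a), i (σ.unop (Fin.castAdd n a))))
        (fun a => (k (Fin.castAdd n a), k (τ.unop (Fin.castAdd n a)))))
      (hasIntegralEq_entries_mul Ay
        (fun b => (i (Fin.natAdd m b), i (σ.unop (Fin.natAdd m b))))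
        (fun b => (k (Fin.natAdd m b), k (τ.unop (Fin.natAdd m b)))))
  convert h using 1
  · ext p
    rw [permOp, permOp, star_sum, Finset.sum_mul_sum, Finset.sum_mul, weight_one_one]
    refine Finset.sum_congr rfl fun i _ => ?_
    rw [Finset.sum_mul]
    refine Finset.sum_congr rfl fun k _ => ?_
    rw [star_mul']
    ring
  · have hZ : ∀ a b : ℂ, gaussMass (Fin N) * a * (gaussMass (Fin N) * b) =
        gaussMass (Fin N) * gaussMass (Fin N) * (a * b) := fun a b => by ring
    simp_rw [hZ, ← Finset.mul_sum, Fintype.sum_mul_sum]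
    congr 1
    rw [Finset.sum_congr rfl fun i _ => Finset.sum_comm, Finset.sum_comm,
      Fintype.sum_prod_type]
    refine Fintype.sum_equiv MulOpposite.opEquiv.symm _ _ fun γ₁ => ?_
    rw [Finset.sum_congr rfl fun i _ => Finset.sum_comm, Finset.sum_comm]
    refine Fintype.sum_equiv MulOpposite.opEquiv.symm _ _ fun γ₂ => ?_
    rw [permOp_eq_sum_prod_slot]
    refine (sum_contraction σ τ (blockPerm m n γ₁.unop γ₂.unop) _).symm.trans ?_
    refine Finset.sum_congr rfl fun i _ => Finset.sum_congr rfl fun k _ => ?_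
    simp [Fin.prod_univ_add, slot]

/-- Expectation values in the model with unit couplings of sesquilinear expressions in the
permutation operators. -/
theorem hasExpectation_one_one (c d : SymGrp (m + n) → ℂ) (Ax Ay : Matrix (Fin N) (Fin N) ℂ) :
    HasExpectation 1 1
      (fun X Y => (∑ σ, c σ * permOp σ (X * Ax) (Y * Ay)) *
        star (∑ τ, d τ * permOp τ (X * Ax) (Y * Ay)))
      (∑ σ, ∑ τ, c σ * star (d τ) * ∑ γ : SymGrp m × SymGrp n,
        permOp (σ * blockHom m n γ * τ⁻¹ * (blockHom m n γ)⁻¹) (Axᴴ * Ax) (Ayᴴ * Ay)) := by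
  have h : HasIntegralEq (volume : Measure (Pairs N)) _ _ :=
    HasIntegralEq.sum (s := Finset.univ) fun (σ : SymGrp (m + n)) _ =>
    HasIntegralEq.sum (s := Finset.univ) fun (τ : SymGrp (m + n)) _ =>
    (hasIntegralEq_permOp σ τ Ax Ay).const_mul (c σ * star (d τ))
  have hf : (fun p : Pairs N => (∑ σ, c σ * permOp σ (Matrix.of p.1 * Ax) (Matrix.of p.2 * Ay)) *
        star (∑ τ, d τ * permOp τ (Matrix.of p.1 * Ax) (Matrix.of p.2 * Ay)) * weight 1 1 p) =
      fun p => ∑ σ, ∑ τ, c σ * star (d τ) *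
        (permOp σ (Matrix.of p.1 * Ax) (Matrix.of p.2 * Ay) *
        star (permOp τ (Matrix.of p.1 * Ax) (Matrix.of p.2 * Ay)) * weight 1 1 p) := by
    ext p
    rw [star_sum, Finset.sum_mul_sum, Finset.sum_mul]
    refine Finset.sum_congr rfl fun σ _ => ?_
    rw [Finset.sum_mul]
    refine Finset.sum_congr rfl fun τ _ => ?_
    rw [star_mul']
    ring
  have hZ : partitionFunction (1 : Matrix (Fin N) (Fin N) ℂ) 1 =
      gaussMass (Fin N) * gaussMass (Fin N) := hasIntegralEq_weight_one_one.2
  have hZ0 : gaussMass (Fin N) * gaussMass (Fin N) ≠ 0 :=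
    mul_ne_zero gaussMass_ne_zero gaussMass_ne_zero
  refine ⟨hasIntegralEq_weight_one_one.1, hZ ▸ hZ0, hf ▸ h.1, ?_⟩
  rw [expectation, hf, h.2, hZ]
  simp_rw [mul_left_comm _ (gaussMass (Fin N) * gaussMass (Fin N)), ← Finset.mul_sum]
  rw [← mul_assoc, one_div_mul_cancel hZ0, one_mul]

end TwoPoint

/-! ### Reduction of general couplings to unit couplings -/

section Couplings

variable {N : ℕ}

/-- Right multiplication by an invertible matrix, as a real linear automorphism of the space of
matrices. -/
noncomputable def rightMulEquiv (C : Matrix (Fin N) (Fin N) ℂ) (hC : IsUnit C.det) :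
    (Fin N → Fin N → ℂ) ≃ₗ[ℝ] (Fin N → Fin N → ℂ) where
  toFun x := Matrix.of.symm (Matrix.of x * C)
  invFun x := Matrix.of.symm (Matrix.of x * C⁻¹)
  map_add' x y := by
    change (Matrix.of x + Matrix.of y) * C = _
    rw [Matrix.add_mul]
    rfl
  map_smul' r x := by
    change (r • Matrix.of x) * C = _
    rw [Matrix.smul_mul]
    rfl
  left_inv x := by
    change Matrix.of x * C * C⁻¹ = Matrix.of x
    rw [Matrix.mul_nonsing_inv_cancel_right _ _ hC]
  right_inv x := by
    change Matrix.of x * C⁻¹ * C = Matrix.of x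
    rw [Matrix.nonsing_inv_mul_cancel_right _ _ hC]

/-- A linear change of variables multiplies all integrals by the same nonzero constant. -/
theorem exists_integral_comp_linearEquiv (L : Pairs N ≃ₗ[ℝ] Pairs N) :
    ∃ c : ℝ, c ≠ 0 ∧ ∀ f : Pairs N → ℂ, (Integrable (fun p => f (L p)) ↔ Integrable f) ∧
      ∫ p, f (L p) = c * ∫ p, f p := by
  have hdet : LinearMap.det (L : Pairs N →ₗ[ℝ] Pairs N) ≠ 0 := L.isUnit_det'.ne_zero
  have : (volume : Measure (Fin N → Fin N → ℂ)).IsAddHaarMeasure :=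
    Measure.pi.isAddHaarMeasure fun _ : Fin N => (volume : Measure (Fin N → ℂ))
  have : (volume : Measure (Pairs N)).IsAddHaarMeasure :=
    Measure.prod.instIsAddHaarMeasure (volume : Measure (Fin N → Fin N → ℂ))
      (volume : Measure (Fin N → Fin N → ℂ))
  have hmap := Measure.map_linearMap_addHaar_eq_smul_addHaar
    (volume : Measure (Pairs N)) hdet
  have he : MeasurableEmbedding L :=
    L.toContinuousLinearEquiv.toHomeomorph.measurableEmbedding
  have hpos : 0 < |(LinearMap.det (L : Pairs N →ₗ[ℝ] Pairs N))⁻¹| := abs_pos.2 (inv_ne_zero hdet)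
  refine ⟨_, hpos.ne', fun f => ⟨?_, ?_⟩⟩
  · rw [← integrable_smul_measure (f := f) (ENNReal.ofReal_pos.2 hpos).ne'
      ENNReal.ofReal_ne_top, ← hmap]
    exact (he.integrable_map_iff (g := f)).symm
  · have := he.integral_map (μ := volume) f
    rw [← this]
    erw [hmap]
    rw [integral_smul_measure, ENNReal.toReal_ofReal hpos.le]
    simp

theorem weight_mul (Ax Ay Cx Cy : Matrix (Fin N) (Fin N) ℂ) (hx : Cx * Ax * Cxᴴ = 1)
    (hy : Cy * Ay * Cyᴴ = 1) (p : Pairs N) :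
    weight Ax Ay (Matrix.of.symm (Matrix.of p.1 * Cx), Matrix.of.symm (Matrix.of p.2 * Cy)) =
      weight 1 1 p := by
  have h : ∀ X A C : Matrix (Fin N) (Fin N) ℂ, C * A * Cᴴ = 1 →
      X * C * A * (X * C)ᴴ = X * 1 * Xᴴ := by
    intro X A C hC
    rw [← hC, Matrix.conjTranspose_mul]
    simp only [Matrix.mul_assoc]
  simp only [weight, Equiv.apply_symm_apply, h _ _ _ hx, h _ _ _ hy]

/-- The substitution `(X, Y) ↦ (X C_x, Y C_y)` reduces the model with couplings `A_x, A_y` to the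
model with unit couplings. -/
theorem HasExpectation.of_one_one {Ax Ay Cx Cy : Matrix (Fin N) (Fin N) ℂ}
    (hCx : IsUnit Cx.det) (hCy : IsUnit Cy.det) (hx : Cx * Ax * Cxᴴ = 1)
    (hy : Cy * Ay * Cyᴴ = 1) {f : Matrix (Fin N) (Fin N) ℂ → Matrix (Fin N) (Fin N) ℂ → ℂ} {v : ℂ}
    (h : HasExpectation 1 1 (fun X Y => f (X * Cx) (Y * Cy)) v) :
    HasExpectation Ax Ay f v := by
  obtain ⟨c, hc, hL⟩ := exists_integral_comp_linearEquiv
    ((rightMulEquiv Cx hCx).prodCongr (rightMulEquiv Cy hCy))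
  have hw := hL (fun p => weight Ax Ay p)
  have hf := hL (fun p => f (Matrix.of p.1) (Matrix.of p.2) * weight Ax Ay p)
  have e : ∀ p : Pairs N, ((rightMulEquiv Cx hCx).prodCongr (rightMulEquiv Cy hCy)) p =
    (Matrix.of.symm (Matrix.of p.1 * Cx), Matrix.of.symm (Matrix.of p.2 * Cy)) := fun _ => rfl
  simp only [e, weight_mul Ax Ay Cx Cy hx hy, Equiv.apply_symm_apply] at hw hf
  obtain ⟨h1, h2, h3, h4⟩ := h
  have hc' : (c : ℂ) ≠ 0 := by exact_mod_cast hc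
  rw [partitionFunction, hw.2] at h2
  refine ⟨hw.1.1 h1, right_ne_zero_of_mul h2, hf.1.1 h3, ?_⟩
  rw [← h4, expectation, expectation, hf.2, partitionFunction, partitionFunction, hw.2]
  have := right_ne_zero_of_mul h2
  field_simp

open scoped MatrixOrder in
/-- A positive definite matrix `A` has an invertible `C` with `C A C† = 1`, and then
`A⁻¹ = C† C`. -/
theorem exists_whitening {A : Matrix (Fin N) (Fin N) ℂ} (hA : A.PosDef) :
    ∃ C : Matrix (Fin N) (Fin N) ℂ, IsUnit C.det ∧ C * A * Cᴴ = 1 ∧ Cᴴ * C = A⁻¹ := by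
  obtain ⟨C, hC⟩ := CStarAlgebra.nonneg_iff_eq_star_mul_self.1 hA.inv.posSemidef.nonneg
  rw [Matrix.star_eq_conjTranspose] at hC
  have hAd : IsUnit A.det := (Matrix.isUnit_iff_isUnit_det _).1 hA.isUnit
  have hCd : IsUnit C.det := by
    have : IsUnit (A⁻¹).det := (Matrix.isUnit_iff_isUnit_det _).1 hA.inv.isUnit
    rw [hC, Matrix.det_mul] at this
    exact isUnit_of_mul_isUnit_right this
  refine ⟨C, hCd, ?_, hC.symm⟩
  have h : A * (Cᴴ * C) = 1 := by rw [← hC, Matrix.mul_nonsing_inv _ hAd]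
  have h2 : C * A * Cᴴ * C = C := by
    rw [Matrix.mul_assoc, Matrix.mul_assoc, h, Matrix.mul_one]
  calc C * A * Cᴴ = C * A * Cᴴ * C * C⁻¹ := (Matrix.mul_nonsing_inv_cancel_right _ _ hCd).symm
    _ = 1 := by rw [h2, Matrix.mul_nonsing_inv _ hCd]

end Couplings

/-! ### Orthogonality of matrix elements -/

section Schur

variable {k : ℕ} (D : IrrepSystem k)

theorem card_symGrp : Fintype.card (SymGrp k) = k.factorial := by
  rw [Fintype.card_congr MulOpposite.opEquiv.symm, Fintype.card_perm, Fintype.card_fin]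

/-- The average `∑_σ D^R(σ⁻¹) L D^S(σ)` intertwines `V_S` and `V_R`. -/
noncomputable def averageMap (R S : Nat.Partition k) (L : D.space S →ₗ[ℂ] D.space R) :
    Representation.IntertwiningMap (D.rep S) (D.rep R) where
  toLinearMap := ∑ σ : SymGrp k, D.rep R σ⁻¹ ∘ₗ L ∘ₗ D.rep S σ
  isIntertwining' g := by
    ext v : 1
    simp only [LinearMap.comp_apply, LinearMap.sum_apply, map_sum]
    refine Fintype.sum_equiv (Equiv.mulRight g) _ _ fun σ => ?_
    simp [map_mul]

theorem averageMap_apply (R S : Nat.Partition k) (L : D.space S →ₗ[ℂ] D.space R)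
    (v : D.space S) :
    averageMap D R S L v = ∑ σ : SymGrp k, D.rep R σ⁻¹ (L (D.rep S σ v)) := by
  change (∑ σ : SymGrp k, D.rep R σ⁻¹ ∘ₗ L ∘ₗ D.rep S σ) v = _
  simp

/-- Schur's lemma for inequivalent representations. -/
theorem averageMap_eq_zero {R S : Nat.Partition k} (h : R ≠ S)
    (L : D.space S →ₗ[ℂ] D.space R) : averageMap D R S L = 0 := by
  have := D.irreducible R
  have := D.irreducible S
  have := D.inequivalent S R h.symm
  exact Subsingleton.elim _ _

/-- Schur's lemma for one representation: the average is the scalar `k! Tr L / d_R`. -/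
theorem dim_mul_averageMap_apply {R : Nat.Partition k} (L : D.space R →ₗ[ℂ] D.space R)
    (v : D.space R) :
    (D.dim R : ℂ) • averageMap D R R L v =
      ((k.factorial : ℂ) * LinearMap.trace ℂ _ L) • v := by
  have := D.irreducible R
  obtain ⟨c, hc⟩ := (Representation.IsIrreducible.algebraMap_intertwiningMap_bijective_of_isAlgClosed
    (k := ℂ) (ρ := D.rep R)).2 (averageMap D R R L)
  have hv : ∀ w, averageMap D R R L w = c • w := by
    intro w
    rw [← hc]
    rfl
  have ht : (averageMap D R R L).toLinearMap = c • LinearMap.id := by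
    ext w : 1
    exact hv w
  -- compare traces
  have h2 := congrArg (LinearMap.trace ℂ (D.space R)) ht
  have h3 : ∀ σ : SymGrp k, LinearMap.trace ℂ (D.space R) (D.rep R σ⁻¹ ∘ₗ L ∘ₗ D.rep R σ) =
      LinearMap.trace ℂ (D.space R) L := by
    intro σ
    rw [LinearMap.trace_comp_comm', LinearMap.comp_assoc]
    have : D.rep R σ ∘ₗ D.rep R σ⁻¹ = LinearMap.id := by
      ext w : 1
      simp
    rw [this, LinearMap.comp_id]
  change LinearMap.trace ℂ (D.space R) (∑ σ : SymGrp k, D.rep R σ⁻¹ ∘ₗ L ∘ₗ D.rep R σ) = _ at h2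
  rw [map_sum, Finset.sum_congr rfl fun σ _ => h3 σ, Finset.sum_const, Finset.card_univ,
    card_symGrp, map_smul, LinearMap.trace_id, finrank_euclideanSpace_fin, nsmul_eq_mul,
    smul_eq_mul] at h2
  rw [hv, smul_smul, h2, mul_comm]

theorem sum_matrixElement_of_ne {R S : Nat.Partition k} (h : R ≠ S) (a b : D.space R)
    (c d : D.space S) :
    ∑ σ : SymGrp k, inner ℂ b (D.rep R σ⁻¹ a) * inner ℂ d (D.rep S σ c) = 0 := by
  have h1 := averageMap_apply D R S (InnerProductSpace.rankOne ℂ a d : D.space S →ₗ[ℂ] D.space R) c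
  rw [averageMap_eq_zero D h] at h1
  have h2 := congrArg (inner ℂ b) h1
  simpa [inner_sum, inner_smul_right, mul_comm] using h2.symm

theorem dim_mul_sum_matrixElement {R : Nat.Partition k} (a b c d : D.space R) :
    (D.dim R : ℂ) * ∑ σ : SymGrp k, inner ℂ b (D.rep R σ⁻¹ a) * inner ℂ d (D.rep R σ c) =
      (k.factorial : ℂ) * (inner ℂ d a * inner ℂ b c) := by
  have h1 := dim_mul_averageMap_apply D
    (InnerProductSpace.rankOne ℂ a d : D.space R →ₗ[ℂ] D.space R) c
  rw [averageMap_apply, InnerProductSpace.trace_rankOne] at h1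
  have h2 := congrArg (inner ℂ b) h1
  simpa [inner_sum, inner_smul_right, mul_comm, mul_assoc, mul_left_comm] using h2

theorem inner_rep_left {R : Nat.Partition k} (σ : SymGrp k) (v w : D.space R) :
    inner ℂ (D.rep R σ v) w = inner ℂ v (D.rep R σ⁻¹ w) := by
  rw [← D.unitary R σ v (D.rep R σ⁻¹ w)]
  simp

end Schur

/-! ### The Fourier basis of the group algebra -/

namespace SubgroupBasis

variable {m n : ℕ} {D : IrrepSystem (m + n)} {D₁ : IrrepSystem m} {D₂ : IrrepSystem n}
  {R S : Nat.Partition (m + n)} (E : SubgroupBasis D D₁ D₂ R) (E' : SubgroupBasis D D₁ D₂ S)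
  {R₁ S₁ : Nat.Partition m} {R₂ S₂ : Nat.Partition n}

theorem inner_ket_of_ne (h : (R₁, R₂) ≠ (S₁, S₂)) (m₁ : Fin (D₁.dim R₁)) (m₂ : Fin (D₂.dim R₂))
    (k₁ : Fin (D₁.dim S₁)) (k₂ : Fin (D₂.dim S₂)) (μ : Fin (branchingMult D D₁ D₂ R R₁ R₂))
    (ν : Fin (branchingMult D D₁ D₂ R S₁ S₂)) :
    inner ℂ (E.ket R₁ R₂ m₁ m₂ μ) (E.ket S₁ S₂ k₁ k₂ ν) = 0 :=
  E.basis.inner_eq_zero fun e => h (congrArg Sigma.fst e)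

theorem inner_ket (m₁ k₁ : Fin (D₁.dim R₁)) (m₂ k₂ : Fin (D₂.dim R₂))
    (μ ν : Fin (branchingMult D D₁ D₂ R R₁ R₂)) :
    inner ℂ (E.ket R₁ R₂ m₁ m₂ μ) (E.ket R₁ R₂ k₁ k₂ ν) =
      if m₁ = k₁ ∧ m₂ = k₂ ∧ μ = ν then (1 : ℂ) else 0 := by
  classical
  rw [ket, ket, E.basis.inner_eq_ite]
  simp [and_assoc]

theorem projector_apply (μ ν : Fin (branchingMult D D₁ D₂ R R₁ R₂)) (v : D.space R) :
    E.projector R₁ R₂ μ ν v =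
      ∑ m₁, ∑ m₂, inner ℂ (E.ket R₁ R₂ m₁ m₂ ν) v • E.ket R₁ R₂ m₁ m₂ μ := by
  simp [projector]

theorem projector_ket (μ ν l : Fin (branchingMult D D₁ D₂ R R₁ R₂)) (m₁ : Fin (D₁.dim R₁))
    (m₂ : Fin (D₂.dim R₂)) :
    E.projector R₁ R₂ μ ν (E.ket R₁ R₂ m₁ m₂ l) =
      if ν = l then E.ket R₁ R₂ m₁ m₂ μ else 0 := by
  simp [projector_apply, inner_ket, ite_and, ite_smul]

theorem projector_ket_of_ne (h : (R₁, R₂) ≠ (S₁, S₂))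
    (μ ν : Fin (branchingMult D D₁ D₂ R R₁ R₂)) (m₁ : Fin (D₁.dim S₁)) (m₂ : Fin (D₂.dim S₂))
    (l : Fin (branchingMult D D₁ D₂ R S₁ S₂)) :
    E.projector R₁ R₂ μ ν (E.ket S₁ S₂ m₁ m₂ l) = 0 := by
  simp [projector_apply, inner_ket_of_ne E h]

theorem rep_blockHom_ket (γ : SymGrp m × SymGrp n) (m₁ : Fin (D₁.dim R₁)) (m₂ : Fin (D₂.dim R₂))
    (ν : Fin (branchingMult D D₁ D₂ R R₁ R₂)) :
    D.rep R (blockHom m n γ) (E.ket R₁ R₂ m₁ m₂ ν) =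
      ∑ k₁ : Fin (D₁.dim R₁), ∑ k₂ : Fin (D₂.dim R₂),
        (D₁.entry R₁ γ.1 k₁ m₁ * D₂.entry R₂ γ.2 k₂ m₂) • E.ket R₁ R₂ k₁ k₂ ν :=
  E.action γ.1 γ.2 R₁ R₂ m₁ m₂ ν

/-- The operators `P^R_{R₁,R₂,μ,ν}` commute with `S_m × S_n`, which acts in the same way on the
copies `μ` and `ν`. -/
theorem projector_comp_rep_blockHom (μ ν : Fin (branchingMult D D₁ D₂ R R₁ R₂))
    (γ : SymGrp m × SymGrp n) :
    E.projector R₁ R₂ μ ν ∘ₗ D.rep R (blockHom m n γ) =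
      D.rep R (blockHom m n γ) ∘ₗ E.projector R₁ R₂ μ ν := by
  refine E.basis.toBasis.ext ?_
  rintro ⟨⟨T₁, T₂⟩, ⟨m₁, m₂⟩, l⟩
  rw [OrthonormalBasis.coe_toBasis, LinearMap.comp_apply, LinearMap.comp_apply]
  change E.projector R₁ R₂ μ ν (D.rep R (blockHom m n γ) (E.ket T₁ T₂ m₁ m₂ l)) =
    D.rep R (blockHom m n γ) (E.projector R₁ R₂ μ ν (E.ket T₁ T₂ m₁ m₂ l))
  rw [rep_blockHom_ket]
  by_cases h : (R₁, R₂) = (T₁, T₂)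
  · obtain ⟨rfl, rfl⟩ := Prod.mk.inj h
    simp only [map_sum, map_smul, projector_ket]
    split_ifs
    · rw [rep_blockHom_ket]
    · simp
  · simp [projector_ket_of_ne E h]

theorem restrictedCharacter_eq_sum_inner (μ ν : Fin (branchingMult D D₁ D₂ R R₁ R₂))
    (σ : SymGrp (m + n)) :
    E.restrictedCharacter R₁ R₂ μ ν σ = ∑ p : Fin (D₁.dim R₁) × Fin (D₂.dim R₂),
      inner ℂ (E.ket R₁ R₂ p.1 p.2 ν) (D.rep R σ (E.ket R₁ R₂ p.1 p.2 μ)) := by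
  have h : ∀ x y : D.space R, LinearMap.trace ℂ (D.space R)
      ((InnerProductSpace.rankOne ℂ x y : D.space R →ₗ[ℂ] D.space R) * D.rep R σ) =
      inner ℂ y (D.rep R σ x) := by
    intro x y
    rw [LinearMap.trace_mul_comm, ← InnerProductSpace.trace_rankOne]
    congr 1
    ext v : 1
    simp
  rw [restrictedCharacter, projector, ← Module.End.mul_eq_comp, Fintype.sum_prod_type]
  simp only [Finset.sum_mul, map_sum, h]

theorem star_restrictedCharacter (μ ν : Fin (branchingMult D D₁ D₂ R R₁ R₂))
    (σ : SymGrp (m + n)) :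
    star (E.restrictedCharacter R₁ R₂ μ ν σ) = E.restrictedCharacter R₁ R₂ ν μ σ⁻¹ := by
  simp only [restrictedCharacter_eq_sum_inner, star_sum]
  refine Finset.sum_congr rfl fun p _ => ?_
  rw [← inner_rep_left]
  exact inner_conj_symm _ _

theorem restrictedCharacter_conj (μ ν : Fin (branchingMult D D₁ D₂ R R₁ R₂))
    (γ : SymGrp m × SymGrp n) (σ : SymGrp (m + n)) :
    E.restrictedCharacter R₁ R₂ μ ν ((blockHom m n γ)⁻¹ * σ * blockHom m n γ) =
      E.restrictedCharacter R₁ R₂ μ ν σ := by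
  have h := projector_comp_rep_blockHom E μ ν γ⁻¹
  rw [map_inv] at h
  have h1 : D.rep R (blockHom m n γ) ∘ₗ D.rep R (blockHom m n γ)⁻¹ = LinearMap.id := by
    ext w : 1
    simp
  rw [restrictedCharacter, map_mul, map_mul, Module.End.mul_eq_comp, Module.End.mul_eq_comp,
    LinearMap.comp_assoc, ← LinearMap.comp_assoc, h, LinearMap.comp_assoc,
    LinearMap.trace_comp_comm', LinearMap.comp_assoc, LinearMap.comp_assoc, h1,
    LinearMap.comp_id, restrictedCharacter]

/-- The coefficient of `σ` in `Q^R_{R₁,R₂,μ,ν}`. -/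
noncomputable def qCoeff (μ ν : Fin (branchingMult D D₁ D₂ R R₁ R₂)) (σ : SymGrp (m + n)) : ℂ :=
  (D.dim R : ℂ) / ((m + n).factorial : ℂ) * E.restrictedCharacter R₁ R₂ μ ν σ⁻¹

theorem groupDelta_qElement_mul (μ ν : Fin (branchingMult D D₁ D₂ R R₁ R₂))
    (σ : SymGrp (m + n)) :
    groupDelta (E.qElement R₁ R₂ μ ν * MonoidAlgebra.single σ⁻¹ 1) = E.qCoeff μ ν σ := by
  classical
  have h : ∀ τ : SymGrp (m + n), τ⁻¹ * σ⁻¹ = 1 ↔ τ = σ⁻¹ := fun τ => by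
    rw [mul_eq_one_iff_eq_inv, inv_inv, inv_eq_iff_eq_inv]
  simp [groupDelta, qElement, qCoeff, Finset.sum_mul, MonoidAlgebra.single_mul_single,
    Finsupp.single_apply, h]

theorem star_qCoeff (μ ν : Fin (branchingMult D D₁ D₂ R R₁ R₂)) (σ : SymGrp (m + n)) :
    star (E.qCoeff μ ν σ) = E.qCoeff ν μ σ⁻¹ := by
  rw [qCoeff, qCoeff, star_mul', star_restrictedCharacter]
  simp

theorem qCoeff_conj (μ ν : Fin (branchingMult D D₁ D₂ R R₁ R₂)) (γ : SymGrp m × SymGrp n)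
    (σ : SymGrp (m + n)) :
    E.qCoeff μ ν ((blockHom m n γ)⁻¹ * σ * blockHom m n γ) = E.qCoeff μ ν σ := by
  rw [qCoeff, qCoeff, ← restrictedCharacter_conj E μ ν γ σ⁻¹]
  simp [mul_assoc]

/-- The convolution of two restricted characters, as a sum over the matrix elements to which the
orthogonality relations apply. -/
theorem sum_qCoeff_mul_eq (μ₁ ν₁ : Fin (branchingMult D D₁ D₂ R R₁ R₂))
    (μ₂ ν₂ : Fin (branchingMult D D₁ D₂ S S₁ S₂)) (ρ : SymGrp (m + n)) :
    ∑ σ, E.qCoeff μ₁ ν₁ σ * E'.qCoeff ν₂ μ₂ (σ⁻¹ * ρ) =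
      (D.dim S : ℂ) / ((m + n).factorial : ℂ) *
        ∑ p : Fin (D₁.dim R₁) × Fin (D₂.dim R₂), ∑ q : Fin (D₁.dim S₁) × Fin (D₂.dim S₂),
          (D.dim R : ℂ) / ((m + n).factorial : ℂ) * ∑ σ,
            inner ℂ (E.ket R₁ R₂ p.1 p.2 ν₁) (D.rep R σ⁻¹ (E.ket R₁ R₂ p.1 p.2 μ₁)) *
            inner ℂ (D.rep S ρ (E'.ket S₁ S₂ q.1 q.2 μ₂))
              (D.rep S σ (E'.ket S₁ S₂ q.1 q.2 ν₂)) := by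
  simp only [Finset.mul_sum]
  rw [Finset.sum_congr rfl fun p _ => Finset.sum_comm, Finset.sum_comm]
  refine Finset.sum_congr rfl fun σ _ => ?_
  rw [qCoeff, qCoeff, mul_mul_mul_comm, restrictedCharacter_eq_sum_inner,
    restrictedCharacter_eq_sum_inner, Finset.sum_mul_sum, Finset.mul_sum]
  refine Finset.sum_congr rfl fun p _ => ?_
  rw [Finset.mul_sum]
  refine Finset.sum_congr rfl fun q _ => ?_
  simp only [_root_.mul_inv_rev, inv_inv, map_mul, Module.End.mul_apply, inner_rep_left]
  ring

theorem sum_qCoeff_mul_of_ne (h : R ≠ S) (μ₁ ν₁ : Fin (branchingMult D D₁ D₂ R R₁ R₂))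
    (μ₂ ν₂ : Fin (branchingMult D D₁ D₂ S S₁ S₂)) (ρ : SymGrp (m + n)) :
    ∑ σ, E.qCoeff μ₁ ν₁ σ * E'.qCoeff ν₂ μ₂ (σ⁻¹ * ρ) = 0 := by
  rw [sum_qCoeff_mul_eq]
  simp [sum_matrixElement_of_ne D h]

/-- The orthogonality relations with the normalization `d_R / (m + n)!` of the `Q`-basis. -/
theorem sum_matrixElement (v w x y : D.space R) :
    (D.dim R : ℂ) / ((m + n).factorial : ℂ) *
      ∑ σ, inner ℂ v (D.rep R σ⁻¹ w) * inner ℂ x (D.rep R σ y) =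
        inner ℂ x w * inner ℂ v y := by
  have h := dim_mul_sum_matrixElement D w v y x
  have : ((m + n).factorial : ℂ) ≠ 0 := by exact_mod_cast (m + n).factorial_ne_zero
  field_simp
  linear_combination h

theorem sum_qCoeff_mul_of_ne_label (h : (R₁, R₂) ≠ (S₁, S₂))
    (μ₁ ν₁ : Fin (branchingMult D D₁ D₂ R R₁ R₂))
    (μ₂ ν₂ : Fin (branchingMult D D₁ D₂ R S₁ S₂)) (ρ : SymGrp (m + n)) :
    ∑ σ, E.qCoeff μ₁ ν₁ σ * E.qCoeff ν₂ μ₂ (σ⁻¹ * ρ) = 0 := by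
  rw [sum_qCoeff_mul_eq]
  simp [sum_matrixElement, inner_ket_of_ne E h]

/-- The `Q`-basis multiplies like matrix units in the multiplicity labels:
`Q^R_{R₁,R₂,μ₁,ν₁} Q^R_{R₁,R₂,ν₂,μ₂} = δ_{ν₁ν₂} Q^R_{R₁,R₂,μ₁,μ₂}`. -/
theorem sum_qCoeff_mul (μ₁ ν₁ μ₂ ν₂ : Fin (branchingMult D D₁ D₂ R R₁ R₂))
    (ρ : SymGrp (m + n)) :
    ∑ σ, E.qCoeff μ₁ ν₁ σ * E.qCoeff ν₂ μ₂ (σ⁻¹ * ρ) =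
      if ν₁ = ν₂ then E.qCoeff μ₁ μ₂ ρ else 0 := by
  rw [sum_qCoeff_mul_eq]
  simp only [sum_matrixElement, inner_ket]
  split_ifs with h
  · rw [qCoeff, restrictedCharacter_eq_sum_inner]
    congr 1
    refine Finset.sum_congr rfl fun p _ => ?_
    rw [Finset.sum_eq_single p]
    · simp [h, inner_rep_left]
    · intro q _ hq
      rw [if_neg, mul_zero]
      exact fun e => hq (Prod.ext e.1 e.2.1).symm
    · simp
  · simp [h]

end SubgroupBasis

open SubgroupBasis

variable {m n N : ℕ} {D : IrrepSystem (m + n)} {D₁ : IrrepSystem m} {D₂ : IrrepSystem n}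
  {R S : Nat.Partition (m + n)} (E : SubgroupBasis D D₁ D₂ R) (E' : SubgroupBasis D D₁ D₂ S)
  {R₁ S₁ : Nat.Partition m} {R₂ S₂ : Nat.Partition n}

theorem fourierOp_eq (μ ν : Fin (branchingMult D D₁ D₂ R R₁ R₂))
    (X Y : Matrix (Fin N) (Fin N) ℂ) :
    fourierOp E R₁ R₂ μ ν X Y = ∑ σ, E.qCoeff μ ν σ * permOp σ X Y := by
  simp only [fourierOp, groupDelta_qElement_mul]

/-- The sum over Wick contractions of two operators of the Fourier basis is governed by the
product of the two elements of the group algebra, every element of `S_m × S_n` giving the same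
contribution. -/
theorem sum_contractions_eq (μ₁ ν₁ : Fin (branchingMult D D₁ D₂ R R₁ R₂))
    (μ₂ ν₂ : Fin (branchingMult D D₁ D₂ S S₁ S₂)) (X Y : Matrix (Fin N) (Fin N) ℂ) :
    ∑ σ, ∑ τ, E.qCoeff μ₁ ν₁ σ * star (E'.qCoeff μ₂ ν₂ τ) * ∑ γ : SymGrp m × SymGrp n,
        permOp (σ * blockHom m n γ * τ⁻¹ * (blockHom m n γ)⁻¹) X Y =
      (m.factorial : ℂ) * (n.factorial : ℂ) *
        ∑ ρ, (∑ σ, E.qCoeff μ₁ ν₁ σ * E'.qCoeff ν₂ μ₂ (σ⁻¹ * ρ)) * permOp ρ X Y := by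
  have h : ∀ γ : SymGrp m × SymGrp n, ∀ σ,
      ∑ τ, E.qCoeff μ₁ ν₁ σ * star (E'.qCoeff μ₂ ν₂ τ) *
        permOp (σ * blockHom m n γ * τ⁻¹ * (blockHom m n γ)⁻¹) X Y =
      ∑ ρ, E.qCoeff μ₁ ν₁ σ * E'.qCoeff ν₂ μ₂ (σ⁻¹ * ρ) * permOp ρ X Y := by
    intro γ σ
    -- substitute `ρ = σ γ τ⁻¹ γ⁻¹` for `τ`
    refine Fintype.sum_equiv (((Equiv.inv _).trans
      (Equiv.mulLeft (σ * blockHom m n γ))).trans (Equiv.mulRight (blockHom m n γ)⁻¹)) _ _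
      fun τ => ?_
    rw [star_qCoeff, ← qCoeff_conj E' ν₂ μ₂ γ (σ⁻¹ * _)]
    simp [mul_assoc]
  simp only [Finset.mul_sum]
  rw [Finset.sum_congr rfl fun σ _ => Finset.sum_comm, Finset.sum_comm]
  simp only [h, Finset.sum_const, Finset.card_univ, Fintype.card_prod, card_symGrp, nsmul_eq_mul,
    Nat.cast_mul, Finset.sum_mul]
  rw [Finset.sum_comm]
  simp only [Finset.mul_sum]

/-- Orthogonality of the Fourier basis, for the sum over Wick contractions. -/
theorem sum_contractions_eq_ite (E : ∀ R : Nat.Partition (m + n), SubgroupBasis D D₁ D₂ R)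
    {R S : Nat.Partition (m + n)} {R₁ S₁ : Nat.Partition m} {R₂ S₂ : Nat.Partition n}
    (μ₁ ν₁ : Fin (branchingMult D D₁ D₂ R R₁ R₂)) (μ₂ ν₂ : Fin (branchingMult D D₁ D₂ S S₁ S₂))
    (X Y : Matrix (Fin N) (Fin N) ℂ) :
    ∑ σ, ∑ τ, (E R).qCoeff μ₁ ν₁ σ * star ((E S).qCoeff μ₂ ν₂ τ) *
        ∑ γ : SymGrp m × SymGrp n,
          permOp (σ * blockHom m n γ * τ⁻¹ * (blockHom m n γ)⁻¹) X Y =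
      if h : R = S ∧ R₁ = S₁ ∧ R₂ = S₂ then
        if (ν₁ : ℕ) = (ν₂ : ℕ) then
          (m.factorial : ℂ) * (n.factorial : ℂ) *
            fourierOp (E R) R₁ R₂ μ₁ (Fin.cast (by obtain ⟨rfl, rfl, rfl⟩ := h; rfl) μ₂) X Y
        else 0
      else 0 := by
  rw [sum_contractions_eq]
  by_cases hR : R = S
  · subst hR
    by_cases h : (R₁, R₂) = (S₁, S₂)
    · obtain ⟨rfl, rfl⟩ := Prod.mk.inj h
      rw [dif_pos ⟨rfl, rfl, rfl⟩]
      simp only [SubgroupBasis.sum_qCoeff_mul, Fin.ext_iff]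
      split_ifs
      · rw [fourierOp_eq]
        rfl
      · simp
    · rw [dif_neg fun h' => h (Prod.ext h'.2.1 h'.2.2)]
      simp [SubgroupBasis.sum_qCoeff_mul_of_ne_label _ h]
  · rw [dif_neg fun h' => hR h'.1]
    simp [SubgroupBasis.sum_qCoeff_mul_of_ne _ _ hR]

end TwoMatrix

theorem mainTheorem6 {m n N : ℕ}
    (D : TwoMatrix.IrrepSystem (m + n)) (D₁ : TwoMatrix.IrrepSystem m)
    (D₂ : TwoMatrix.IrrepSystem n)
    (E : ∀ R : Nat.Partition (m + n), TwoMatrix.SubgroupBasis D D₁ D₂ R)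
    (R S : Nat.Partition (m + n)) (R₁ S₁ : Nat.Partition m) (R₂ S₂ : Nat.Partition n)
    (μ₁ ν₁ : Fin (TwoMatrix.branchingMult D D₁ D₂ R R₁ R₂))
    (μ₂ ν₂ : Fin (TwoMatrix.branchingMult D D₁ D₂ S S₁ S₂)) :
    -- coupling witnesses
    (∀ Ax Ay : Matrix (Fin N) (Fin N) ℂ, Ax.PosDef → Ay.PosDef →
      TwoMatrix.HasExpectation Ax Ay
        (fun X Y => TwoMatrix.fourierOp (E R) R₁ R₂ μ₁ ν₁ X Y *
          star (TwoMatrix.fourierOp (E S) S₁ S₂ μ₂ ν₂ X Y))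
        (if h : R = S ∧ R₁ = S₁ ∧ R₂ = S₂ then
          if (ν₁ : ℕ) = (ν₂ : ℕ) then
            (m.factorial : ℂ) * (n.factorial : ℂ) *
              TwoMatrix.fourierOp (E R) R₁ R₂ μ₁
                (Fin.cast (by obtain ⟨rfl, rfl, rfl⟩ := h; rfl) μ₂) Ax⁻¹ Ay⁻¹
          else 0
        else 0)) ∧
    -- classical witnesses
    (∀ Ax Ay : Matrix (Fin N) (Fin N) ℂ,
      TwoMatrix.HasExpectation 1 1
        (fun X Y => TwoMatrix.fourierOp (E R) R₁ R₂ μ₁ ν₁ (X * Ax) (Y * Ay) *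
          star (TwoMatrix.fourierOp (E S) S₁ S₂ μ₂ ν₂ (X * Ax) (Y * Ay)))
        (if h : R = S ∧ R₁ = S₁ ∧ R₂ = S₂ then
          if (ν₁ : ℕ) = (ν₂ : ℕ) then
            (m.factorial : ℂ) * (n.factorial : ℂ) *
              TwoMatrix.fourierOp (E R) R₁ R₂ μ₁
                (Fin.cast (by obtain ⟨rfl, rfl, rfl⟩ := h; rfl) μ₂)
                (Ax.conjTranspose * Ax) (Ay.conjTranspose * Ay)
          else 0
        else 0)) := by
  have key : ∀ Ax Ay : Matrix (Fin N) (Fin N) ℂ, TwoMatrix.HasExpectation 1 1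
      (fun X Y => TwoMatrix.fourierOp (E R) R₁ R₂ μ₁ ν₁ (X * Ax) (Y * Ay) *
        star (TwoMatrix.fourierOp (E S) S₁ S₂ μ₂ ν₂ (X * Ax) (Y * Ay))) _ := fun Ax Ay => by
    simp only [TwoMatrix.fourierOp_eq]
    exact TwoMatrix.hasExpectation_one_one _ _ Ax Ay
  simp only [TwoMatrix.sum_contractions_eq_ite] at key
  refine ⟨fun Ax Ay hAx hAy => ?_, key⟩
  obtain ⟨Cx, hCx, hx, hBx⟩ := TwoMatrix.exists_whitening hAx
  obtain ⟨Cy, hCy, hy, hBy⟩ := TwoMatrix.exists_whitening hAy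
  rw [← hBx, ← hBy]
  exact TwoMatrix.HasExpectation.of_one_one hCx hCy hx hy (key Cx Cy)
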